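/- Let $k$ be a field and let $\mathcal H=(V,E)$ be a hypergraph with finite vertex set $V=\{x_1,\dots,x_n\}$ and a non-empty set $E$ of edges $e\subseteq V$ such that $|e|\ge 2$ for every $e\in E$ and no edge is contained in a different edge. A vertex cover of $\mathcal H$ is a subset of $V$ that meets every edge; the cover ideal $J=J(\mathcal H)\subseteq R=k[x_1,\dots,x_n]$ is the ideal generated by the monomials $\prod_{x\in\Gamma}x$, where $\Gamma$ runs over the vertex covers of $\mathcal H$. Let $\chi=\chi(\mathcal H)$ be the chromatic number of $\mathcal H$, i.e. the least number of colours in a colouring of $V$ for which no edge is monochromatic, and let $h$ be the big height of $J$, i.e. the maximum of the heights of the associated primes of $R/J$. For an ideal $I\subseteq R$ and an integer $s\ge 0$, write $I^{(s)}=\bigcap_{P\in\operatorname{Ass}(R/I)}(I^sR_P\cap R)$ for the $s$-th symbolic power and $$\rho_a(I)=\sup\Big\{\tfrac st \;:\; s,t\in\mathbb Z_{>0},\ I^{(sr)}\not\subseteq I^{tr}\ \text{for all } r\gg 0\Big\}$$ for the asymptotic resurgence (the supremum being taken in $[-\infty,\infty]$). Then $h$ is finite, and 1. $J^{(rh-h)}\subseteq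 J^r$ for all integers $r\ge\chi$; 2. $\rho_a(J)\le h-\dfrac1\chi$; and this bound is at least as good as $h-\frac1n$, that is, $h-\frac1\chi\le h-\frac1n$. -/

import Mathlib

noncomputable section

namespace Ideal

variable {R : Type*} [CommRing R]

/-- The big height of an ideal `I`: the supremum of the heights of the associated primes of `I`,
i.e. of the associated primes of the module `R ⧸ I`. -/
def bigHeight (I : Ideal R) : ℕ∞ :=
  ⨆ P ∈ associatedPrimes R (R ⧸ I), P.height

/-- The `s`-th symbolic power of `I`: the intersection, over the associated primes `P` of `I`,
of the contractions to `R` of the extensions of `I ^ s` to the localizations `R_P`. -/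
def symbolicPower (I : Ideal R) (s : ℕ) : Ideal R :=
  ⨅ P : {P : Ideal R // P ∈ associatedPrimes R (R ⧸ I)},
    haveI : P.1.IsPrime := P.2.isPrime
    ((I ^ s).map (algebraMap R (Localization.AtPrime P.1))).comap
      (algebraMap R (Localization.AtPrime P.1))

/-- The asymptotic resurgence of `I`: the supremum of all `s / t` with positive integers `s`, `t`
such that the `(s r)`-th symbolic power of `I` is not contained in `I ^ (t r)` for `r ≫ 0`.
The supremum is taken in the extended reals, so that it is `⊤` if the set is unbounded. -/
def asymptoticResurgence (I : Ideal R) : EReal :=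
  sSup {q : EReal | ∃ s t : ℕ, 0 < s ∧ 0 < t ∧ q = (((s : ℝ) / (t : ℝ) : ℝ) : EReal) ∧
    ∀ᶠ r : ℕ in Filter.atTop, ¬ I.symbolicPower (s * r) ≤ I ^ (t * r)}

end Ideal

namespace Hypergraph

variable {α : Type*}

/-- Finite simple hypergraphs: there are finitely many vertices, at least one edge, every edge has
at least two vertices, and no edge is contained in a different edge. -/
structure IsFiniteSimple (H : Hypergraph α) : Prop where
  finite_vertexSet : H.vertexSet.Finite
  edgeSet_nonempty : H.edgeSet.Nonempty
  two_le_encard : ∀ e ∈ H.edgeSet, 2 ≤ e.encard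
  isAntichain : IsAntichain (· ⊆ ·) H.edgeSet

/-- A set of vertices is a vertex cover if it meets every edge. -/
def IsVertexCover (H : Hypergraph α) (Γ : Finset H.vertexSet) : Prop :=
  ∀ e ∈ H.edgeSet, ∃ x ∈ Γ, (x : α) ∈ e

/-- The cover ideal of `H`, in the polynomial ring over `k` whose variables are the vertices
of `H`, is generated by the products of the variables over the vertex covers. -/
def coverIdeal (k : Type*) [Field k] (H : Hypergraph α) : Ideal (MvPolynomial H.vertexSet k) :=
  Ideal.span {f | ∃ Γ : Finset H.vertexSet, H.IsVertexCover Γ ∧ f = ∏ x ∈ Γ, MvPolynomial.X x}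

/-- A colouring of the vertices is proper if no edge is monochromatic. -/
def IsProperColoring (H : Hypergraph α) {C : Type*} (c : H.vertexSet → C) : Prop :=
  ∀ e ∈ H.edgeSet, ∃ x y : H.vertexSet, (x : α) ∈ e ∧ (y : α) ∈ e ∧ c x ≠ c y

/-- The chromatic number of `H`: the least number of colours in a proper colouring. -/
def chromaticNumber (H : Hypergraph α) : ℕ :=
  sInf {m : ℕ | ∃ c : H.vertexSet → Fin m, H.IsProperColoring c}

/-- The chromatic number of a finite simple hypergraph is attained: the minimum in its definition
is over a nonempty set. -/
theorem IsFiniteSimple.exists_isProperColoring {H : Hypergraph α} (hH : H.IsFiniteSimple) :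
    ∃ c : H.vertexSet → Fin H.chromaticNumber, H.IsProperColoring c := by
  have hne : {m : ℕ | ∃ c : H.vertexSet → Fin m, H.IsProperColoring c}.Nonempty := by
    have : Finite H.vertexSet := hH.finite_vertexSet.to_subtype
    obtain ⟨m, ⟨f⟩⟩ := Finite.exists_equiv_fin H.vertexSet
    refine ⟨m, f, fun e he => ?_⟩
    have h2 : 1 < e.encard :=
      lt_of_lt_of_le (by norm_num) (hH.two_le_encard e he)
    obtain ⟨a, b, ha, hb, hab⟩ := Set.one_lt_encard_iff.mp h2
    have hsub : e ⊆ H.vertexSet := H.subset_vertexSet_of_mem_edgeSet he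
    exact ⟨⟨a, hsub ha⟩, ⟨b, hsub hb⟩, ha, hb, fun h => hab (by simpa using h)⟩
  exact Nat.sInf_mem hne

end Hypergraph

end

/-! Write `P_e` for the prime generated by the variables of an edge `e`. Then `J` is the
intersection of the `P_e`, and since edges form an antichain these are exactly its associated
primes, so `h` is the largest edge size. A monomial `x^a` occurring in an element of `J^(s)` has
`∑_{x ∈ e} a x ≥ s` for every edge `e`; both containments thus become statements about exponents.

If all edge sums are at least `h(r-1)` and `c` is a proper colouring with at most `r` colours, the
sets `Γ_i = {a x ≥ r} ∪ {a x = r-1, c x ≠ i}` for `i < r` are vertex covers, and `x` lies in at most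
`a x` of them, so `x^a ∈ J^r` (`monomial_mem_coverIdeal_pow_of_coloring`).

For the resurgence, an exponent with edge sums at least `n(χh-1)` is split into `n` nearly equal
parts, each with edge sums at least `χh-h`. Hence `J^(n(χh-1)) ⊆ J^(χn)`, and the ratio `(χh-1)/χ`
bounds `ρ_a(J)`. -/

open MvPolynomial

/-! ### Primes generated by variables, and the order along a set of variables -/

section CoordinateIdeals

variable {σ k : Type*} [Field k]

/-- The ideal generated by the variables in a set. -/
noncomputable abbrev variableIdeal (k : Type*) [Field k] (s : Set σ) : Ideal (MvPolynomial σ k) :=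
  Ideal.span (X '' s)

/-- The least degree in the variables of `s` of a monomial occurring in a polynomial. -/
noncomputable def orderAlong (s : Set σ) (f : MvPolynomial σ k) : ℕ∞ :=
  (f : MvPowerSeries σ k).weightedOrder (s.indicator 1)

theorem natCast_le_orderAlong_iff {s : Set σ} {f : MvPolynomial σ k} {n : ℕ} :
    (n : ℕ∞) ≤ orderAlong s f ↔
      ∀ d ∈ f.support, n ≤ Finsupp.weight (s.indicator (1 : σ → ℕ)) d := by
  constructor
  · intro h d hd
    have h1 : MvPowerSeries.coeff d (f : MvPowerSeries σ k) ≠ 0 := by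
      rwa [MvPolynomial.coeff_coe, ← mem_support_iff]
    exact_mod_cast h.trans (MvPowerSeries.weightedOrder_le (s.indicator 1) h1)
  · intro h
    refine MvPowerSeries.nat_le_weightedOrder _ fun d hd => ?_
    rw [MvPolynomial.coeff_coe]
    by_contra hne
    exact absurd (h d (mem_support_iff.2 hne)) (not_le.2 hd)

theorem orderAlong_mul (s : Set σ) (f g : MvPolynomial σ k) :
    orderAlong s (f * g) = orderAlong s f + orderAlong s g := by
  rw [orderAlong, MvPolynomial.coe_mul, MvPowerSeries.weightedOrder_mul]; rfl

theorem one_le_weight_indicator_iff {s : Set σ} {d : σ →₀ ℕ} :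
    1 ≤ Finsupp.weight (s.indicator (1 : σ → ℕ)) d ↔ ∃ x ∈ s, d x ≠ 0 := by
  constructor
  · intro h
    by_contra! hc
    have : Finsupp.weight (s.indicator (1 : σ → ℕ)) d = 0 := by
      rw [Finsupp.weight_apply]
      refine Finset.sum_eq_zero fun x _ => ?_
      by_cases hx : x ∈ s <;> simp [hx, hc]
    omega
  · rintro ⟨x, hx, hd⟩
    exact (Nat.one_le_iff_ne_zero.2 hd).trans (Finsupp.le_weight _ (by simp [hx]) d)

theorem mem_variableIdeal_iff_one_le_orderAlong {s : Set σ} {f : MvPolynomial σ k} :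
    f ∈ variableIdeal k s ↔ 1 ≤ orderAlong s f := by
  rw [mem_ideal_span_X_image, ← Nat.cast_one, natCast_le_orderAlong_iff]
  simp only [one_le_weight_indicator_iff]

/-- The ideal of polynomials of order at least `n` along a set of variables. -/
def orderIdeal (k : Type*) [Field k] (s : Set σ) (n : ℕ) : Ideal (MvPolynomial σ k) where
  carrier := {f | (n : ℕ∞) ≤ orderAlong s f}
  zero_mem' := by simp [orderAlong]
  add_mem' {f g} hf hg := by
    simp only [Set.mem_ofPred_eq, orderAlong, MvPolynomial.coe_add] at *
    exact (le_min hf hg).trans (MvPowerSeries.min_weightedOrder_le_add _)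
  smul_mem' c f hf := by
    simp only [Set.mem_ofPred_eq, smul_eq_mul, orderAlong_mul] at *
    exact hf.trans le_add_self

theorem mem_orderIdeal {s : Set σ} {n : ℕ} {f : MvPolynomial σ k} :
    f ∈ orderIdeal k s n ↔ (n : ℕ∞) ≤ orderAlong s f := Iff.rfl

theorem variableIdeal_pow_le_orderIdeal (s : Set σ) (n : ℕ) :
    variableIdeal k s ^ n ≤ orderIdeal k s n := by
  induction n with
  | zero => intro f _; simp [mem_orderIdeal]
  | succ n ih =>
    rw [pow_succ, Ideal.mul_le]
    intro f hf g hg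
    rw [mem_orderIdeal, orderAlong_mul, Nat.cast_succ]
    exact add_le_add (ih hf) (mem_variableIdeal_iff_one_le_orderAlong.1 hg)

/-- Order is additive on products and vanishes outside the prime, so the factor `u` contributes
nothing. -/
theorem mem_orderIdeal_of_mul_mem {s : Set σ} {n : ℕ} {u f : MvPolynomial σ k}
    (hu : u ∉ variableIdeal k s) (h : u * f ∈ orderIdeal k s n) : f ∈ orderIdeal k s n := by
  rw [mem_variableIdeal_iff_one_le_orderAlong, Order.one_le_iff_ne_zero, not_not] at hu
  rwa [mem_orderIdeal, orderAlong_mul, hu, zero_add] at h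

instance variableIdeal_isPrime (s : Set σ) : (variableIdeal k s).IsPrime := by
  refine ⟨?_, fun {f g} h => ?_⟩
  · rw [Ideal.ne_top_iff_one, mem_ideal_span_X_image]
    intro h
    obtain ⟨i, -, hi⟩ := h 0 (by simp)
    exact hi rfl
  · simp only [mem_variableIdeal_iff_one_le_orderAlong, Order.one_le_iff_ne_zero,
      orderAlong_mul] at *
    contrapose! h
    simp [h.1, h.2]

theorem X_mem_variableIdeal_iff {s : Set σ} {x : σ} :
    (X x : MvPolynomial σ k) ∈ variableIdeal k s ↔ x ∈ s := by
  refine ⟨fun h => ?_, fun h => Ideal.subset_span ⟨x, h, rfl⟩⟩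
  classical
  rw [mem_ideal_span_X_image] at h
  obtain ⟨i, hi, hne⟩ := h (Finsupp.single x 1) (by simp [mem_support_iff])
  rw [Finsupp.single_apply] at hne
  split_ifs at hne with hx
  · rwa [hx]
  · exact absurd rfl hne

theorem height_variableIdeal [Finite σ] (s : Set σ) :
    (variableIdeal k s).height = s.ncard := by
  apply le_antisymm
  · refine (Ideal.height_le_card_of_mem_minimalPrimes_span ((Set.toFinite s).image X)
      (p := variableIdeal k s) ?_).trans ?_
    · rw [Ideal.minimalPrimes_eq_subsingleton_self]; rfl
    · exact_mod_cast Set.ncard_image_le (Set.toFinite s)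
  · induction s, Set.toFinite s using Set.Finite.induction_on with
    | empty => simp
    | @insert a s ha hs ih =>
      rw [Set.ncard_insert_of_notMem ha hs, Nat.cast_succ]
      refine (add_le_add_left ih 1).trans (Ideal.height_add_one_le_of_lt_of_isPrime ?_)
      refine lt_of_le_of_ne (Ideal.span_mono (Set.image_mono (Set.subset_insert a s))) ?_
      intro heq
      apply ha
      rw [← X_mem_variableIdeal_iff (k := k), heq, X_mem_variableIdeal_iff]
      exact Set.mem_insert a s

end CoordinateIdeals

theorem Ideal.exists_notMem_mul_mem_of_mem_symbolicPower {R : Type*} [CommRing R] {I P : Ideal R}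
    (hP : P ∈ associatedPrimes R (R ⧸ I)) {s : ℕ} {f : R} (hf : f ∈ I.symbolicPower s) :
    ∃ u ∉ P, u * f ∈ I ^ s := by
  have hprime : P.IsPrime := hP.isPrime
  rw [Ideal.symbolicPower, Ideal.mem_iInf] at hf
  have h := hf ⟨P, hP⟩
  rw [Ideal.mem_comap, IsLocalization.algebraMap_mem_map_algebraMap_iff P.primeCompl] at h
  obtain ⟨u, hu, h⟩ := h
  exact ⟨u, hu, h⟩

/-- Hermite's identity: replacing `a` by `a + 1` shifts the window of summation, trading the term `a
/ n` for `(a + n) / n = a / n + 1`. -/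
theorem Nat.sum_range_add_div {n : ℕ} (hn : 0 < n) (a : ℕ) :
    ∑ j ∈ Finset.range n, (a + j) / n = a := by
  induction a with
  | zero =>
    refine Finset.sum_eq_zero fun j hj => ?_
    rw [zero_add, Nat.div_eq_of_lt (Finset.mem_range.1 hj)]
  | succ a ih =>
    have h1 := Finset.sum_range_succ (fun j => (a + j) / n) n
    rw [Finset.sum_range_succ', ih, Nat.add_div_right a hn] at h1
    have h2 : ∀ j, (a + 1 + j) / n = (a + (j + 1)) / n := fun j => by congr 1; omega
    simp only [h2]
    simp only [add_zero] at h1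
    omega

/-! ### Associated primes and symbolic powers of the cover ideal -/

namespace Hypergraph

variable {α k : Type*} [Field k] {H : Hypergraph α}

/-- A set of elements of `α`, as a set of vertices. -/
abbrev trace (H : Hypergraph α) (e : Set α) : Set H.vertexSet := Subtype.val ⁻¹' e

theorem ncard_trace {e : Set α} (he : e ∈ H.edgeSet) : (H.trace e).ncard = e.ncard :=
  Set.ncard_preimage_of_injective_subset_range Subtype.val_injective
    (by simpa using H.subset_vertexSet_of_mem_edgeSet he)

/-- The product of the variables in a finite set is the monomial of its indicator. -/
theorem prod_X_eq_monomial {σ : Type*} (Γ : Finset σ) :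
    ∏ x ∈ Γ, (X x : MvPolynomial σ k) = monomial (∑ x ∈ Γ, Finsupp.single x 1) 1 := by
  rw [monomial_sum_one]; rfl

theorem sum_single_one_apply {σ : Type*} [DecidableEq σ] (Γ : Finset σ) (y : σ) :
    (∑ x ∈ Γ, Finsupp.single x 1 : σ →₀ ℕ) y = if y ∈ Γ then 1 else 0 := by
  simp [Finsupp.finsetSum_apply, Finsupp.single_apply]

theorem mem_coverIdeal_iff {f : MvPolynomial H.vertexSet k} :
    f ∈ H.coverIdeal k ↔ ∀ e ∈ H.edgeSet, f ∈ variableIdeal k (H.trace e) := by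
  classical
  constructor
  · intro hf e he
    refine (Ideal.span_le.2 ?_ : H.coverIdeal k ≤ variableIdeal k (H.trace e)) hf
    rintro _ ⟨Γ, hΓ, rfl⟩
    obtain ⟨x, hx, hxe⟩ := hΓ e he
    exact Ideal.mem_of_dvd _ (Finset.dvd_prod_of_mem _ hx) (X_mem_variableIdeal_iff.2 hxe)
  · intro hf
    rw [f.as_sum]
    refine Ideal.sum_mem _ fun d hd => ?_
    -- Each monomial of `f` meets every edge, so it is divisible by the squarefree monomial of its
    -- support, a generator.
    have hcover : H.IsVertexCover d.support := by
      intro e he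
      obtain ⟨x, hx, hdx⟩ := mem_ideal_span_X_image.1 (hf e he) d hd
      exact ⟨x, Finsupp.mem_support_iff.2 hdx, hx⟩
    refine Ideal.mem_of_dvd _ ?_ (Ideal.subset_span ⟨d.support, hcover, rfl⟩)
    rw [prod_X_eq_monomial, monomial_dvd_monomial]
    refine ⟨Or.inr fun y => ?_, one_dvd _⟩
    rw [sum_single_one_apply]
    split_ifs with hy
    · exact Nat.one_le_iff_ne_zero.2 (Finsupp.mem_support_iff.1 hy)
    · exact Nat.zero_le _

theorem mem_associatedPrimes_coverIdeal_iff [Finite H.vertexSet]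
    {P : Ideal (MvPolynomial H.vertexSet k)} :
    P ∈ associatedPrimes _ (MvPolynomial H.vertexSet k ⧸ H.coverIdeal k) ↔
      P.IsPrime ∧ ∃ f, ∀ a, a ∈ P ↔ a * f ∈ H.coverIdeal k := by
  rw [AssociatedPrimes.mem_iff, IsAssociatedPrime, Submodule.isAssociatedPrime_iff]
  refine and_congr_right fun _ => ?_
  rw [(Ideal.Quotient.mk_surjective (I := H.coverIdeal k)).exists]
  refine exists_congr fun f => ?_
  rw [Ideal.ext_iff]
  refine forall_congr' fun a => ?_
  rw [Submodule.mem_colon_singleton, Submodule.mem_bot, ← Ideal.Quotient.eq_zero_iff_mem (I := H.coverIdeal k), map_mul]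
  rfl

theorem associatedPrimes_coverIdeal (hH : H.IsFiniteSimple) :
    associatedPrimes _ (MvPolynomial H.vertexSet k ⧸ H.coverIdeal k) =
      (fun e => variableIdeal k (H.trace e)) '' H.edgeSet := by
  classical
  have : Finite H.vertexSet := hH.finite_vertexSet.to_subtype
  have hfin : H.edgeSet.Finite :=
    hH.finite_vertexSet.finite_subsets.subset fun e he => H.subset_vertexSet_of_mem_edgeSet he
  ext P
  rw [mem_associatedPrimes_coverIdeal_iff]
  constructor
  · rintro ⟨hP, f, hf⟩
    let F := hfin.toFinset.filter fun e => f ∉ variableIdeal k (H.trace e)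
    -- `(J : f)` is the intersection of those `P_e` not containing `f`; a prime that is a finite
    -- intersection equals one of its members.
    have hPF : P = F.inf fun e => variableIdeal k (H.trace e) := by
      ext a
      rw [hf, mem_coverIdeal_iff, Submodule.mem_finsetInf]
      simp only [F, Finset.mem_filter, Set.Finite.mem_toFinset,
        (variableIdeal_isPrime _).mul_mem_iff_mem_or_mem]
      refine forall_congr' fun e => ?_
      tauto
    obtain ⟨e, he, hPe⟩ := Ideal.eq_inf_of_isPrime_inf (hPF ▸ hP)
    exact ⟨e, by simpa using (Finset.mem_filter.1 he).1, hPe.trans hPF.symm⟩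
  · rintro ⟨e, he, rfl⟩
    have : Fintype H.vertexSet := Fintype.ofFinite _
    -- The product of the variables outside `e` lies in `P_e'` unless `e' ⊆ e`, which the antichain
    -- condition allows only for `e' = e`.
    refine ⟨variableIdeal_isPrime _, ∏ x with x ∉ H.trace e, X x, fun a => ?_⟩
    rw [mem_coverIdeal_iff]
    have hprod : ∀ s : Set H.vertexSet, (∏ x with x ∉ H.trace e, X x) ∈ variableIdeal k s ↔
        ¬ s ⊆ H.trace e := by
      intro s
      rw [(variableIdeal_isPrime s).prod_mem_iff, Set.not_subset]
      simp [X_mem_variableIdeal_iff, and_comm]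
    simp only [(variableIdeal_isPrime _).mul_mem_iff_mem_or_mem, hprod]
    constructor
    · intro ha e' he'
      by_cases hee : e' = e
      · exact Or.inl (hee ▸ ha)
      · refine Or.inr fun hsub => hH.isAntichain he' he hee fun x hx => ?_
        exact hsub (a := ⟨x, H.subset_vertexSet_of_mem_edgeSet he' hx⟩) hx
    · intro h
      simpa using h e he

theorem exists_bigHeight_coverIdeal (hH : H.IsFiniteSimple) :
    ∃ h : ℕ, (H.coverIdeal k).bigHeight = (h : ℕ∞) ∧ 2 ≤ h ∧ ∀ e ∈ H.edgeSet, e.ncard ≤ h := by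
  have : Finite H.vertexSet := hH.finite_vertexSet.to_subtype
  have hfin : H.edgeSet.Finite :=
    hH.finite_vertexSet.finite_subsets.subset fun e he => H.subset_vertexSet_of_mem_edgeSet he
  obtain ⟨e₀, he₀, hmax⟩ := hfin.exists_maximalFor Set.ncard _ hH.edgeSet_nonempty
  have hmax' : ∀ e ∈ H.edgeSet, e.ncard ≤ e₀.ncard := fun e he =>
    (le_total e.ncard e₀.ncard).elim id fun h => hmax he h
  refine ⟨e₀.ncard, ?_, ?_, hmax'⟩
  · rw [Ideal.bigHeight, associatedPrimes_coverIdeal hH, iSup_image]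
    apply le_antisymm
    · refine iSup₂_le fun e he => ?_
      rw [height_variableIdeal, ncard_trace he]
      exact_mod_cast hmax' e he
    · refine le_iSup₂_of_le e₀ he₀ ?_
      rw [height_variableIdeal, ncard_trace he₀]
  · have h2 := hH.two_le_encard e₀ he₀
    rw [← (hH.finite_vertexSet.subset
      (H.subset_vertexSet_of_mem_edgeSet he₀)).cast_ncard_eq] at h2
    exact_mod_cast h2

theorem symbolicPower_coverIdeal_le_orderIdeal (hH : H.IsFiniteSimple) {e : Set α}
    (he : e ∈ H.edgeSet) (s : ℕ) :
    (H.coverIdeal k).symbolicPower s ≤ orderIdeal k (H.trace e) s := by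
  intro f hf
  have hP : variableIdeal k (H.trace e) ∈
      associatedPrimes _ (MvPolynomial H.vertexSet k ⧸ H.coverIdeal k) := by
    rw [associatedPrimes_coverIdeal hH]
    exact Set.mem_image_of_mem _ he
  obtain ⟨u, hu, huf⟩ := Ideal.exists_notMem_mul_mem_of_mem_symbolicPower hP hf
  refine mem_orderIdeal_of_mul_mem hu (variableIdeal_pow_le_orderIdeal _ _ ?_)
  exact Ideal.pow_right_mono (fun g hg => mem_coverIdeal_iff.1 hg e he) s huf

/-- Containment of a symbolic power in an ordinary power can be checked on monomials. -/
theorem symbolicPower_coverIdeal_le_pow (hH : H.IsFiniteSimple) {s r : ℕ}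
    (h : ∀ a : H.vertexSet →₀ ℕ,
      (∀ e ∈ H.edgeSet, s ≤ Finsupp.weight ((H.trace e).indicator (1 : H.vertexSet → ℕ)) a) →
      monomial a (1 : k) ∈ H.coverIdeal k ^ r) :
    (H.coverIdeal k).symbolicPower s ≤ H.coverIdeal k ^ r := by
  intro f hf
  rw [f.as_sum]
  refine Ideal.sum_mem _ fun d hd => ?_
  rw [← mul_one (coeff d f), ← C_mul_monomial]
  refine Ideal.mul_mem_left _ _ (h d fun e he => ?_)
  exact natCast_le_orderAlong_iff.1 (symbolicPower_coverIdeal_le_orderIdeal hH he s hf) d hd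

/-! ### Vertex covers built from a colouring -/

theorem monomial_mem_coverIdeal_pow [DecidableEq H.vertexSet] {r : ℕ} {a : H.vertexSet →₀ ℕ}
    (Γ : Fin r → Finset H.vertexSet) (hΓ : ∀ i, H.IsVertexCover (Γ i))
    (ha : ∀ x, (Finset.univ.filter fun i => x ∈ Γ i).card ≤ a x) :
    monomial a (1 : k) ∈ H.coverIdeal k ^ r := by
  have hmem : ∏ i, ∏ x ∈ Γ i, (X x : MvPolynomial H.vertexSet k) ∈ H.coverIdeal k ^ r := by
    have := Ideal.prod_mem_prod (s := Finset.univ) (I := fun _ : Fin r => H.coverIdeal k)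
      (x := fun i => ∏ x ∈ Γ i, X x) fun i _ => Ideal.subset_span ⟨Γ i, hΓ i, rfl⟩
    simpa using this
  refine Ideal.mem_of_dvd _ ?_ hmem
  simp only [prod_X_eq_monomial]
  rw [← monomial_sum_one, monomial_dvd_monomial]
  refine ⟨Or.inr fun y => ?_, one_dvd _⟩
  rw [Finsupp.finsetSum_apply]
  simp only [sum_single_one_apply]
  simpa using ha y

theorem weight_trace [Fintype H.vertexSet] (e : Set α) [DecidablePred (· ∈ H.trace e)]
    (a : H.vertexSet →₀ ℕ) :
    Finsupp.weight ((H.trace e).indicator (1 : H.vertexSet → ℕ)) a = ∑ x with x ∈ H.trace e, a x := by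
  rw [Finsupp.weight_eq_sum, Finset.sum_filter]
  refine Finset.sum_congr rfl fun x _ => ?_
  by_cases hx : x ∈ H.trace e <;> simp [hx]

theorem card_filter_trace [Fintype H.vertexSet] {e : Set α} [DecidablePred (· ∈ H.trace e)]
    (he : e ∈ H.edgeSet) : (Finset.univ.filter (· ∈ H.trace e)).card = e.ncard := by
  rw [← ncard_trace he, ← Set.ncard_coe_finset]
  congr 1
  ext x
  simp

theorem monomial_mem_coverIdeal_pow_of_coloring [Finite H.vertexSet] {m r h : ℕ}
    {c : H.vertexSet → Fin m} (hc : H.IsProperColoring c) (hmr : m ≤ r)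
    (hh : ∀ e ∈ H.edgeSet, e.ncard ≤ h) {a : H.vertexSet →₀ ℕ}
    (ha : ∀ e ∈ H.edgeSet,
      r * h - h ≤ Finsupp.weight ((H.trace e).indicator (1 : H.vertexSet → ℕ)) a) :
    monomial a (1 : k) ∈ H.coverIdeal k ^ r := by
  classical
  have : Fintype H.vertexSet := Fintype.ofFinite _
  refine monomial_mem_coverIdeal_pow
    (fun i : Fin r => Finset.univ.filter fun x => r ≤ a x ∨ (a x + 1 = r ∧ (c x : ℕ) ≠ i)) ?_ ?_
  · intro i e he
    by_contra! hcon
    simp only [Finset.mem_filter, Finset.mem_univ, true_and] at hcon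
    have hle : ∀ x ∈ Finset.univ.filter (· ∈ H.trace e), a x ≤ r - 1 := by
      intro x hx
      by_contra hlt
      exact hcon x (Or.inl (by omega)) (Finset.mem_filter.1 hx).2
    have hsum := ha e he
    rw [weight_trace] at hsum
    have hcard : (Finset.univ.filter (· ∈ H.trace e)).card ≤ h :=
      (card_filter_trace he).trans_le (hh e he)
    have hmul : r * h - h = h * (r - 1) := by
      rw [Nat.mul_sub_one, mul_comm]
    have hsum' : ∑ x with x ∈ H.trace e, (r - 1) ≤ ∑ x with x ∈ H.trace e, a x := by
      rw [Finset.sum_const, smul_eq_mul]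
      exact (Nat.mul_le_mul_right _ hcard).trans (hmul ▸ hsum)
    -- An edge missed by `Γ_i` leaves no slack: every exponent on it is exactly `r - 1`, so all its
    -- vertices have colour `i`.
    have heq := (Finset.sum_eq_sum_iff_of_le hle).1 (le_antisymm (Finset.sum_le_sum hle) hsum')
    obtain ⟨x, y, hx, hy, hxy⟩ := hc e he
    have hr : 0 < r := i.pos
    have key : ∀ z : H.vertexSet, (z : α) ∈ e → (c z : ℕ) = i := by
      intro z hz
      by_contra hne
      have := heq z (by simpa using hz)
      exact hcon z (Or.inr ⟨by omega, hne⟩) hz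
    exact hxy (Fin.ext ((key x hx).trans (key y hy).symm))
  · intro x
    simp only [Finset.mem_filter, Finset.mem_univ, true_and]
    rcases lt_trichotomy (a x + 1) r with hlt | heq | hgt
    · rw [Finset.card_eq_zero.2]
      · exact Nat.zero_le _
      · refine Finset.filter_eq_empty_iff.2 fun i _ => ?_
        omega
    -- When `a x = r - 1`, the vertex is absent from the cover indexed by its own colour, an index
    -- below `r` because `m ≤ r`.
    · have hsub : (Finset.univ.filter fun i : Fin r => r ≤ a x ∨ (a x + 1 = r ∧ (c x : ℕ) ≠ i)) ⊆
          Finset.univ.erase ⟨c x, (c x).2.trans_le hmr⟩ := by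
        intro i hi
        rw [Finset.mem_erase]
        refine ⟨fun hi' => ?_, Finset.mem_univ _⟩
        simp [hi'] at hi
        omega
      refine (Finset.card_le_card hsub).trans ?_
      rw [Finset.card_erase_of_mem (Finset.mem_univ _), Finset.card_univ, Fintype.card_fin]
      omega
    · exact (Finset.card_le_univ _).trans (by rw [Fintype.card_fin]; omega)

theorem monomial_mem_coverIdeal_pow_mul_of_coloring [Finite H.vertexSet] {m n h : ℕ} (hn : 0 < n)
    (hh₀ : 0 < h) {c : H.vertexSet → Fin m} (hc : H.IsProperColoring c)
    (hh : ∀ e ∈ H.edgeSet, e.ncard ≤ h) {a : H.vertexSet →₀ ℕ}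
    (ha : ∀ e ∈ H.edgeSet,
      n * (m * h - 1) ≤ Finsupp.weight ((H.trace e).indicator (1 : H.vertexSet → ℕ)) a) :
    monomial a (1 : k) ∈ H.coverIdeal k ^ (m * n) := by
  classical
  have : Fintype H.vertexSet := Fintype.ofFinite _
  let b : ℕ → H.vertexSet →₀ ℕ := fun j => Finsupp.equivFunOnFinite.symm fun x => (a x + j) / n
  have hb : ∀ j x, b j x = (a x + j) / n := fun j x => rfl
  have hab : a = ∑ j ∈ Finset.range n, b j := by
    ext x
    rw [Finsupp.finsetSum_apply]
    simp only [hb, Nat.sum_range_add_div hn]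
  have hbmem : ∀ j ∈ Finset.range n, monomial (b j) (1 : k) ∈ H.coverIdeal k ^ m := by
    intro j _
    refine monomial_mem_coverIdeal_pow_of_coloring hc le_rfl hh fun e he => ?_
    have hsum := ha e he
    rw [weight_trace] at hsum ⊢
    set s := Finset.univ.filter (· ∈ H.trace e)
    have hcard : s.card ≤ h := (card_filter_trace he).trans_le (hh e he)
    -- Rounding down loses at most `n - 1` per vertex, hence at most `h(n-1)` on an edge, and
    -- `n(mh-1) - h(n-1) = n(mh-h-1) + h > n(mh-h-1)`.
    have hx : ∀ x ∈ s, a x ≤ n * b j x + (n - 1) := by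
      intro x _
      have h1 := Nat.div_add_mod (a x + j) n
      have h2 := Nat.mod_lt (a x + j) hn
      rw [hb]
      omega
    have hle := Finset.sum_le_sum hx
    rw [Finset.sum_add_distrib, ← Finset.mul_sum, Finset.sum_const, smul_eq_mul] at hle
    have hle' : n * (m * h - 1) ≤ n * (∑ x ∈ s, b j x) + h * (n - 1) :=
      hsum.trans (hle.trans (Nat.add_le_add_left (Nat.mul_le_mul_right _ hcard) _))
    by_contra! hlt
    -- Here `hlt` forces `m * h > h`, so the truncated subtractions are genuine.
    have hmh : n * (m * h - 1) = n * ((m * h - h) + (h - 1)) := by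
      congr 1
      omega
    have h3 : n * (∑ x ∈ s, b j x + 1) ≤ n * (m * h - h) := Nat.mul_le_mul_left _ hlt
    obtain ⟨n, rfl⟩ := Nat.exists_eq_succ_of_ne_zero hn.ne'
    obtain ⟨h, rfl⟩ := Nat.exists_eq_succ_of_ne_zero hh₀.ne'
    simp only [Nat.succ_eq_add_one, Nat.add_sub_cancel] at *
    nlinarith
  rw [hab, monomial_sum_one, pow_mul]
  simpa using Ideal.prod_mem_prod hbmem

theorem IsFiniteSimple.chromaticNumber_pos (hH : H.IsFiniteSimple) : 0 < H.chromaticNumber := by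
  obtain ⟨c, hc⟩ := hH.exists_isProperColoring
  obtain ⟨e, he⟩ := hH.edgeSet_nonempty
  obtain ⟨x, -⟩ := hc e he
  exact (c x).pos

theorem IsFiniteSimple.chromaticNumber_le_ncard (hH : H.IsFiniteSimple) :
    H.chromaticNumber ≤ H.vertexSet.ncard := by
  have : Finite H.vertexSet := hH.finite_vertexSet.to_subtype
  refine Nat.sInf_le ⟨Finite.equivFinOfCardEq (Nat.card_coe_set_eq _), fun e he => ?_⟩
  have h2 : 1 < e.encard := lt_of_lt_of_le (by norm_num) (hH.two_le_encard e he)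
  obtain ⟨a, b, ha, hb, hab⟩ := Set.one_lt_encard_iff.mp h2
  have hsub : e ⊆ H.vertexSet := H.subset_vertexSet_of_mem_edgeSet he
  exact ⟨⟨a, hsub ha⟩, ⟨b, hsub hb⟩, ha, hb, fun h => hab (by simpa using h)⟩

end Hypergraph

/-! ### Asymptotic resurgence and the main theorem -/

theorem Ideal.symbolicPower_anti {R : Type*} [CommRing R] (I : Ideal R) :
    Antitone I.symbolicPower := fun _ _ h =>
  iInf_mono fun _ => Ideal.comap_mono (Ideal.map_mono (Ideal.pow_le_pow_right h))

theorem Ideal.asymptoticResurgence_le {R : Type*} [CommRing R] (I : Ideal R) {p q : ℕ}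
    (hq : 0 < q) (h : ∀ n : ℕ, 0 < n → I.symbolicPower (n * p) ≤ I ^ (q * n)) :
    I.asymptoticResurgence ≤ (((p : ℝ) / q : ℝ) : EReal) := by
  refine sSup_le ?_
  rintro _ ⟨s, t, hs, ht, rfl, hev⟩
  rw [EReal.coe_le_coe_iff]
  by_contra! hlt
  rw [div_lt_div_iff₀ (by exact_mod_cast hq) (by exact_mod_cast ht)] at hlt
  have hlt' : p * t < s * q := by exact_mod_cast hlt
  obtain ⟨N, hN⟩ := Filter.eventually_atTop.1 hev
  -- A multiple of `q` beyond `N`: if `s/t > p/q`, then `s * r ≥ t * (N + 1) * p` for `r = q * (N +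
  -- 1)`, and `h` with `n = t * (N + 1)` gives containment in `I ^ (t * r)`.
  refine hN (q * (N + 1)) (by nlinarith) ?_
  have h1 : t * (N + 1) * p ≤ s * (q * (N + 1)) := by nlinarith
  refine (I.symbolicPower_anti h1).trans ((h _ (by positivity)).trans (le_of_eq ?_))
  congr 1
  ring

theorem mainTheorem2 {k : Type*} [Field k] {α : Type*} (H : Hypergraph α)
    (hH : H.IsFiniteSimple) :
    ∃ h : ℕ, (H.coverIdeal k).bigHeight = (h : ℕ∞) ∧
      (∀ r : ℕ, H.chromaticNumber ≤ r →
        (H.coverIdeal k).symbolicPower (r * h - h) ≤ H.coverIdeal k ^ r) ∧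
      (H.coverIdeal k).asymptoticResurgence ≤
        (((h : ℝ) - 1 / (H.chromaticNumber : ℝ) : ℝ) : EReal) ∧
      (h : ℝ) - 1 / (H.chromaticNumber : ℝ) ≤ (h : ℝ) - 1 / (H.vertexSet.ncard : ℝ) := by
  have : Finite H.vertexSet := hH.finite_vertexSet.to_subtype
  obtain ⟨h, hbig, h2, hle⟩ := Hypergraph.exists_bigHeight_coverIdeal (k := k) hH
  obtain ⟨c, hc⟩ := hH.exists_isProperColoring
  have hpos := hH.chromaticNumber_pos
  have hpos' : (0 : ℝ) < H.chromaticNumber := by exact_mod_cast hpos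
  refine ⟨h, hbig, fun r hr => ?_, ?_, ?_⟩
  · exact Hypergraph.symbolicPower_coverIdeal_le_pow hH fun a ha =>
      Hypergraph.monomial_mem_coverIdeal_pow_of_coloring hc hr hle ha
  · have hres := (H.coverIdeal k).asymptoticResurgence_le (p := H.chromaticNumber * h - 1) hpos
      fun n hn => Hypergraph.symbolicPower_coverIdeal_le_pow hH fun a ha =>
        Hypergraph.monomial_mem_coverIdeal_pow_mul_of_coloring hn (by omega) hc hle ha
    convert hres using 2
    have h1 : 1 ≤ H.chromaticNumber * h := Nat.mul_pos hpos (by omega)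
    rw [Nat.cast_sub h1]
    push_cast
    field_simp
  · have hn : (H.chromaticNumber : ℝ) ≤ H.vertexSet.ncard := by
      exact_mod_cast hH.chromaticNumber_le_ncard
    exact sub_le_sub_left (one_div_le_one_div_of_le hpos' hn) _
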